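/- Let $k$ be any field. All graphs are finite and simple. For a graph $G$ with vertices $x_1,\dots,x_n$, let $R_k(G)=k[x_1,\dots,x_n]$, let $I(G)\subseteq R_k(G)$ be the ideal generated by the monomials $x_ix_j$ such that $\{x_i,x_j\}$ is an edge of $G$, and let $\mathrm{pd}(G)=\mathrm{pd}^k(G)$ denote the projective dimension of $R_k(G)/I(G)$ as an $R_k(G)$-module. (1) If $G$ is (isomorphic to) the disjoint union of two graphs $G_1$ and $G_2$, then $\mathrm{pd}(G)=\mathrm{pd}(G_1)+\mathrm{pd}(G_2)$. (2) Consequently, if $G_1,\dots,G_m$ are the connected components of a graph $G$, then $\mathrm{pd}(G)=\sum_{j=1}^m \mathrm{pd}(G_j)$. -/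

import Mathlib

universe u v

/-- The graph ideal `I(G)` of a graph `G` with vertex set `V` in the polynomial ring
`k[x_v : v ∈ V]`: it is generated by the monomials `x_a x_b` with `{a, b}` an edge of `G`. -/
noncomputable def SimpleGraph.graphIdeal (k : Type u) [Field k] {V : Type v} (G : SimpleGraph V) :
    Ideal (MvPolynomial V k) :=
  Ideal.span {p | ∃ a b : V, G.Adj a b ∧ p = MvPolynomial.X a * MvPolynomial.X b}

/-- The projective dimension of a graph `G` over the field `k`: the projective dimension of
`k[x_v : v ∈ V] / I(G)` as a module over `k[x_v : v ∈ V]`. -/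
noncomputable def SimpleGraph.pd (k : Type u) [Field k] {V : Type v} (G : SimpleGraph V) :
    WithBot ℕ∞ :=
  CategoryTheory.projectiveDimension
    (ModuleCat.of (MvPolynomial V k) (MvPolynomial V k ⧸ G.graphIdeal k))

/-! Put `M = R₁/I(G₁)` and `N = R₂/I(G₂)`. No edge joins the two parts, so the quotient ring of the
disjoint union is the external tensor product `M ⊗ N` over `R₁ ⊗ R₂`, and the claim becomes pd(M ⊗
N) = pd M + pd N.

The bound ≤ is dimension shifting: over a field the external tensor product `T` is exact in each
variable and preserves projectives (`hasProjectiveDimensionLE_add`).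

For ≥, edge ideals are homogeneous, so `M` and `N` have minimal syzygies: in each 0 → K → F → M → 0
the kernel lies in 𝔪F. Maps T(F, L) → k then vanish on T(K, L). This vanishing persists to all Ext
groups (`mk₀_comp_eq_zero`), so the connecting maps Extⁿ(T(K, N), k) → Extⁿ⁺¹(T(M, N), k) are
injective (`nontrivial_ext_succ`). Starting from a nonzero map to k on the product of the last
syzygies, one gets a nonzero class in Extᵃ⁺ᵇ(M ⊗ N, k) whenever a ≤ pd M and b ≤ pd N. Finiteness of
the dimensions is never needed.

The formula for components follows by adding one component at a time. -/

/-! ### Biexact bifunctors: subadditivity of dimension and injective connecting maps -/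

namespace CategoryTheory
open Abelian Limits

universe w

variable {C₁ : Type*} [Category* C₁] [Abelian C₁] {C₂ : Type*} [Category* C₂] [Abelian C₂]
  {D : Type*} [Category* D] [Abelian D]

/-- A bifunctor between abelian categories which is exact in each variable and which sends pairs
of projective objects to projective objects. -/
structure Functor.IsBiexact (T : C₁ ⥤ C₂ ⥤ D) : Prop where
  zero_left {X Y : C₁} (N : C₂) : (T.map (0 : X ⟶ Y)).app N = 0
  zero_right {X Y : C₂} (M : C₁) : (T.obj M).map (0 : X ⟶ Y) = 0
  shortExact_left {S : ShortComplex C₁} (hS : S.ShortExact) (N : C₂) :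
    (ShortComplex.mk ((T.map S.f).app N) ((T.map S.g).app N)
      (by rw [← NatTrans.comp_app, ← T.map_comp, S.zero, zero_left])).ShortExact
  shortExact_right {S : ShortComplex C₂} (hS : S.ShortExact) (M : C₁) :
    (ShortComplex.mk ((T.obj M).map S.f) ((T.obj M).map S.g)
      (by rw [← (T.obj M).map_comp, S.zero, zero_right])).ShortExact
  projective (P : C₁) (Q : C₂) [Projective P] [Projective Q] : Projective ((T.obj P).obj Q)

namespace Functor.IsBiexact

variable {T : C₁ ⥤ C₂ ⥤ D}

lemma flip (hT : T.IsBiexact) : T.flip.IsBiexact where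
  zero_left M := hT.zero_right M
  zero_right N := hT.zero_left N
  shortExact_left hS M := hT.shortExact_right hS M
  shortExact_right hS N := hT.shortExact_left hS N
  projective Q P _ _ := hT.projective P Q

/-- Dimension shifting along a projective presentation of `N`: `T.obj P` keeps it exact with
projective middle term. -/
lemma hasProjectiveDimensionLE_of_projective (hT : T.IsBiexact) [EnoughProjectives C₂]
    (P : C₁) [Projective P]
    (N : C₂) (b : ℕ) [HasProjectiveDimensionLE N b] :
    HasProjectiveDimensionLE ((T.obj P).obj N) b := by
  induction b generalizing N with
  | zero =>
    have : Projective N := (projective_iff_hasProjectiveDimensionLE_zero N).2 ‹_›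
    exact (projective_iff_hasProjectiveDimensionLE_zero _).1 (hT.projective P N)
  | succ b ih =>
    obtain ⟨p⟩ := EnoughProjectives.presentation N
    have := p.projective
    have hS : (ShortComplex.mk _ _ (Limits.kernel.condition p.f)).ShortExact :=
      { exact := ShortComplex.exact_kernel p.f }
    have h₁ : HasProjectiveDimensionLE (Limits.kernel p.f) b :=
      (hS.hasProjectiveDimensionLT_X₃_iff b p.projective).1 ‹_›
    have := hT.projective P p.p
    exact ((hT.shortExact_right hS P).hasProjectiveDimensionLT_X₃_iff b this).2 (ih _)

/-- The projective dimension is subadditive under a biexact bifunctor. -/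
lemma hasProjectiveDimensionLE_add (hT : T.IsBiexact) [EnoughProjectives C₁] [EnoughProjectives C₂]
    (M : C₁) (N : C₂) (a b : ℕ) [HasProjectiveDimensionLE M a] [HasProjectiveDimensionLE N b] :
    HasProjectiveDimensionLE ((T.obj M).obj N) (a + b) := by
  induction a generalizing M with
  | zero =>
    have : Projective M := (projective_iff_hasProjectiveDimensionLE_zero M).2 ‹_›
    have := hT.hasProjectiveDimensionLE_of_projective M N b
    rwa [zero_add]
  | succ a ih =>
    obtain ⟨p⟩ := EnoughProjectives.presentation M
    have := p.projective
    have hS : (ShortComplex.mk _ _ (Limits.kernel.condition p.f)).ShortExact :=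
      { exact := ShortComplex.exact_kernel p.f }
    have h₁ : HasProjectiveDimensionLE (Limits.kernel p.f) a :=
      (hS.hasProjectiveDimensionLT_X₃_iff a p.projective).1 ‹_›
    have h₂ := hT.hasProjectiveDimensionLE_of_projective p.p N b
    -- The kernel contributes at most `a + b` by induction, the projective term at most `b`.
    have h₃ := (hT.shortExact_left hS N).hasProjectiveDimensionLT_X₃ (a + b + 1) (ih _)
      (hasProjectiveDimensionLT_of_ge _ (b + 1) _ (by lia))
    have : a + 1 + b = a + b + 1 := by lia
    rwa [this]

variable [HasExt.{w} D]

/-- If `K ⟶ F` becomes zero after applying `Hom(T(-, L), Y)` for all `L`, and `F` is projective,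
then it becomes zero after applying `Extⁿ(T(-, N), Y)` for all `n` and `N`. -/
lemma mk₀_comp_eq_zero (hT : T.IsBiexact) [EnoughProjectives C₂]
    {K F : C₁} [Projective F] (i : K ⟶ F) (Y : D)
    (hi : ∀ (L : C₂) (f : (T.obj F).obj L ⟶ Y), (T.map i).app L ≫ f = 0)
    (N : C₂) (n : ℕ) (x : Ext ((T.obj F).obj N) Y n) :
    (Ext.mk₀ ((T.map i).app N)).comp x (zero_add n) = 0 := by
  induction n generalizing N with
  | zero =>
    obtain ⟨f, rfl⟩ := Ext.homEquiv₀.symm.surjective x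
    simp [hi]
  | succ n ih =>
    obtain ⟨p⟩ := EnoughProjectives.presentation N
    have := p.projective
    have hS : (ShortComplex.mk _ _ (Limits.kernel.condition p.f)).ShortExact :=
      { exact := ShortComplex.exact_kernel p.f }
    have := hT.projective F p.p
    -- The middle term is projective, so `x` is the extension class composed with some `y` of degree
    -- `n`; naturality of that class moves `i` onto `y`.
    obtain ⟨y, rfl⟩ := Ext.contravariant_sequence_exact₃ (hT.shortExact_right hS F) Y x
      (Ext.eq_zero_of_projective _) (add_comm 1 n)
    have nat := ShortComplex.ShortExact.extClass_naturality (hT.shortExact_right hS K)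
      (hT.shortExact_right hS F)
      { τ₁ := (T.map i).app _, τ₂ := (T.map i).app _, τ₃ := (T.map i).app _ }
    rw [← Ext.comp_assoc (a₁₂ := 1) _ _ _ (by lia) (by lia) (by lia), ← nat,
      Ext.comp_assoc (a₂₃ := n) _ _ _ (by lia) (by lia) (by lia), ih, Ext.comp_zero]

/-- Under the hypotheses of `mk₀_comp_eq_zero`, the connecting homomorphism of the short exact
sequence `K ⟶ F ⟶ M` is injective on `Ext(T(-, N), Y)`. -/
lemma nontrivial_ext_succ (hT : T.IsBiexact) [EnoughProjectives C₂]
    {S : ShortComplex C₁} (hS : S.ShortExact)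
    [Projective S.X₂] (Y : D)
    (hi : ∀ (L : C₂) (f : (T.obj S.X₂).obj L ⟶ Y), (T.map S.f).app L ≫ f = 0)
    (N : C₂) (n : ℕ) [Nontrivial (Ext ((T.obj S.X₁).obj N) Y n)] :
    Nontrivial (Ext ((T.obj S.X₃).obj N) Y (n + 1)) := by
  obtain ⟨x, hx⟩ := exists_ne (0 : Ext ((T.obj S.X₁).obj N) Y n)
  refine ⟨(hT.shortExact_left hS N).extClass.comp x (add_comm 1 n), 0, fun h ↦ hx ?_⟩
  -- A class killed by the connecting map is pulled back along `S.f`, hence zero.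
  obtain ⟨y, rfl⟩ := Ext.contravariant_sequence_exact₁ (hT.shortExact_left hS N) Y x _ h
  exact hT.mk₀_comp_eq_zero S.f Y hi N n y

end Functor.IsBiexact

end CategoryTheory

/-! ### External tensor products of modules -/

open TensorProduct

namespace TensorProduct

section ExternalModule

variable (k A B M N : Type*) [CommRing k] [CommRing A] [CommRing B] [Algebra k A] [Algebra k B]
  [AddCommGroup M] [Module k M] [Module A M] [IsScalarTower k A M]
  [AddCommGroup N] [Module k N] [Module B N] [IsScalarTower k B N]

/-- The external tensor product of an `A`-module and a `B`-module over `k`, as a module over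
`A ⊗[k] B`. -/
@[reducible]
noncomputable def externalModule : Module (A ⊗[k] B) (M ⊗[k] N) :=
  Module.compHom (M ⊗[k] N) (((Module.endTensorEndAlgHom (R := k) (S := k) (A := k)).comp
    (Algebra.TensorProduct.map (Algebra.lsmul k k M) (Algebra.lsmul k k N)) :
      A ⊗[k] B →ₐ[k] Module.End k (M ⊗[k] N)) : A ⊗[k] B →+* Module.End k (M ⊗[k] N))

attribute [local instance] externalModule

variable {k A B M N}

lemma external_smul_tmul (a : A) (b : B) (m : M) (n : N) :
    (a ⊗ₜ[k] b) • (m ⊗ₜ[k] n) = (a • m) ⊗ₜ[k] (b • n) := rfl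

/-- An additive map out of an external tensor product is linear if it is so on pure tensors. -/
lemma external_map_smul {P : Type*} [AddCommGroup P] [Module (A ⊗[k] B) P]
    (f : M ⊗[k] N →+ P)
    (hf : ∀ (a : A) (b : B) (m : M) (n : N),
      f ((a • m) ⊗ₜ[k] (b • n)) = (a ⊗ₜ[k] b) • f (m ⊗ₜ[k] n))
    (c : A ⊗[k] B) (x : M ⊗[k] N) : f (c • x) = c • f x := by
  induction c with
  | zero => simp
  | add c c' h h' => rw [add_smul, map_add, h, h', add_smul]
  | tmul a b =>
    induction x with
    | zero => simp
    | add x y h h' => rw [smul_add, map_add, h, h', map_add, smul_add]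
    | tmul m n => rw [external_smul_tmul, hf]

variable {M' N' : Type*} [AddCommGroup M'] [Module k M'] [Module A M'] [IsScalarTower k A M']
  [AddCommGroup N'] [Module k N'] [Module B N'] [IsScalarTower k B N']

/-- The functoriality of the external tensor product. -/
noncomputable def externalMap (f : M →ₗ[A] M') (g : N →ₗ[B] N') :
    M ⊗[k] N →ₗ[A ⊗[k] B] M' ⊗[k] N' where
  toFun := TensorProduct.map (f.restrictScalars k) (g.restrictScalars k)
  map_add' := map_add _
  map_smul' := external_map_smul
    (TensorProduct.map (f.restrictScalars k) (g.restrictScalars k)).toAddMonoidHom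
    (fun a b m n ↦ by simp [external_smul_tmul])

lemma externalMap_apply (f : M →ₗ[A] M') (g : N →ₗ[B] N') (x : M ⊗[k] N) :
    externalMap f g x = TensorProduct.map (f.restrictScalars k) (g.restrictScalars k) x := rfl

lemma projective_external_finsupp (ι κ : Type*) :
    Module.Projective (A ⊗[k] B) ((ι →₀ A) ⊗[k] (κ →₀ B)) := by
  let e := finsuppTensorFinsupp k k A B ι κ
  let e' : (ι →₀ A) ⊗[k] (κ →₀ B) ≃ₗ[A ⊗[k] B] (ι × κ →₀ A ⊗[k] B) :=
    { e with
      map_smul' := external_map_smul e.toLinearMap.toAddMonoidHom (fun a b f g ↦ by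
        ext ⟨i, j⟩
        simp [e, finsuppTensorFinsupp_apply]) }
  exact Module.Projective.of_equiv e'.symm

/-- `M` and `N` are retracts of the free modules on their own elements, and `externalMap` carries
the two splittings to one of the tensor product. -/
lemma projective_external [Module.Projective A M] [Module.Projective B N] :
    Module.Projective (A ⊗[k] B) (M ⊗[k] N) := by
  obtain ⟨s, hs⟩ := Module.projective_def'.1 ‹Module.Projective A M›
  obtain ⟨t, ht⟩ := Module.projective_def'.1 ‹Module.Projective B N›
  have := projective_external_finsupp (k := k) (A := A) (B := B) M N
  refine Module.Projective.of_split (externalMap (k := k) s t)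
    (externalMap (Finsupp.linearCombination A id) (Finsupp.linearCombination B id)) ?_
  apply LinearMap.ext
  intro x
  induction x with
  | zero => simp
  | add x y h h' => rw [map_add, h, h', map_add]
  | tmul m n =>
    have h₁ := LinearMap.congr_fun hs m
    have h₂ := LinearMap.congr_fun ht n
    simp only [LinearMap.comp_apply, LinearMap.id_apply] at h₁ h₂
    simp [externalMap_apply, h₁, h₂]

end ExternalModule

end TensorProduct

/-! ### The external tensor product as a biexact bifunctor -/

namespace ModuleCat

open CategoryTheory

variable (k A B : Type u) [Field k] [CommRing A] [CommRing B] [Algebra k A] [Algebra k B]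

attribute [local instance] TensorProduct.externalModule

attribute [local instance] ModuleCat.moduleOfAlgebraModule
  ModuleCat.isScalarTower_of_algebra_moduleCat

/-- The external tensor product over a field, as a bifunctor. -/
noncomputable def externalTensor :
    ModuleCat.{u} A ⥤ ModuleCat.{u} B ⥤ ModuleCat.{u} (A ⊗[k] B) where
  obj M :=
    { obj N := ModuleCat.of (A ⊗[k] B) (M ⊗[k] N)
      map g := ModuleCat.ofHom (TensorProduct.externalMap LinearMap.id g.hom)
      map_id N := by
        ext x
        exact LinearMap.congr_fun (TensorProduct.map_id (R := k)) x
      map_comp f g := by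
        ext x
        exact LinearMap.congr_fun (TensorProduct.map_comp (R := k) LinearMap.id
          (g.hom.restrictScalars k) LinearMap.id (f.hom.restrictScalars k)) x }
  map f :=
    { app N := ModuleCat.ofHom (TensorProduct.externalMap f.hom LinearMap.id)
      naturality N N' g := by
        ext x
        exact LinearMap.congr_fun ((LinearMap.rTensor_comp_lTensor (R := k)
          (f := f.hom.restrictScalars k) (g := g.hom.restrictScalars k)).trans
          (LinearMap.lTensor_comp_rTensor (R := k)
            (f := f.hom.restrictScalars k) (g := g.hom.restrictScalars k)).symm) x }
  map_id M := by
    ext N x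
    exact LinearMap.congr_fun (TensorProduct.map_id (R := k)) x
  map_comp f g := by
    ext N x
    exact LinearMap.congr_fun (TensorProduct.map_comp (R := k)
      (g.hom.restrictScalars k) LinearMap.id (f.hom.restrictScalars k) LinearMap.id) x

lemma externalTensor_isBiexact : (externalTensor k A B).IsBiexact where
  zero_left N := by
    ext x
    exact LinearMap.congr_fun (TensorProduct.map_zero_left (R := k) _) x
  zero_right M := by
    ext x
    exact LinearMap.congr_fun (TensorProduct.map_zero_right (R := k) _) x
  shortExact_left {S} hS N := by
    have hf := (ModuleCat.mono_iff_injective _).1 hS.mono_f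
    have hg := (ModuleCat.epi_iff_surjective _).1 hS.epi_g
    have hfg := (ShortComplex.ShortExact.moduleCat_exact_iff_function_exact S).1 hS.exact
    exact ModuleCat.shortComplex_shortExact _
      (rTensor_exact N (f := S.f.hom.restrictScalars k) (g := S.g.hom.restrictScalars k) hfg hg)
      (Module.Flat.rTensor_preserves_injective_linearMap (S.f.hom.restrictScalars k) hf)
      (LinearMap.rTensor_surjective N (g := S.g.hom.restrictScalars k) hg)
  shortExact_right {S} hS M := by
    have hf := (ModuleCat.mono_iff_injective _).1 hS.mono_f
    have hg := (ModuleCat.epi_iff_surjective _).1 hS.epi_g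
    have hfg := (ShortComplex.ShortExact.moduleCat_exact_iff_function_exact S).1 hS.exact
    exact ModuleCat.shortComplex_shortExact _
      (lTensor_exact M (f := S.f.hom.restrictScalars k) (g := S.g.hom.restrictScalars k) hfg hg)
      (Module.Flat.lTensor_preserves_injective_linearMap (S.f.hom.restrictScalars k) hf)
      (LinearMap.lTensor_surjective M (g := S.g.hom.restrictScalars k) hg)
  projective P Q _ _ := by
    have : Module.Projective A P := (IsProjective.iff_projective P).2 ‹_›
    have : Module.Projective B Q := (IsProjective.iff_projective Q).2 ‹_›
    exact (IsProjective.iff_projective _).1 TensorProduct.projective_external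

end ModuleCat

/-! ### Minimal syzygies and the dimension of an external tensor product -/

namespace ModuleCat

open CategoryTheory Abelian

section

variable {k A : Type u} [Field k] [CommRing A]

/-- `HasMinimalSyzygy ε n M` says that `M` has an `n`-th syzygy, built from projective modules
and minimal with respect to the augmentation `ε`, which has a nonzero `ε`-semilinear functional. -/
inductive HasMinimalSyzygy (ε : A →+* k) : ℕ → ModuleCat.{u} A → Prop
  | zero (M : ModuleCat.{u} A) (φ : M →ₛₗ[ε] k) (hφ : φ ≠ 0) : HasMinimalSyzygy ε 0 M
  | succ (n : ℕ) (S : ShortComplex (ModuleCat.{u} A)) (hS : S.ShortExact) (hP : Projective S.X₂)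
      (hmin : ∀ x : S.X₁, S.f.hom x ∈ (RingHom.ker ε) • (⊤ : Submodule A S.X₂))
      (h : HasMinimalSyzygy ε n S.X₁) : HasMinimalSyzygy ε (n + 1) S.X₃

/-- The residue field of an augmentation, as a module. -/
noncomputable def residue (ε : A →+* k) : ModuleCat.{u} A :=
  letI := Module.compHom k ε
  ModuleCat.of A k

lemma smul_residue_eq_zero (ε : A →+* k) {a : A} (ha : a ∈ RingHom.ker ε) (y : residue ε) :
    a • y = 0 := by
  change ε a * (show k from y) = 0
  rw [RingHom.mem_ker.1 ha, zero_mul]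

end

variable {k A B : Type u} [Field k] [CommRing A] [CommRing B] [Algebra k A] [Algebra k B]

attribute [local instance] TensorProduct.externalModule
attribute [local instance] ModuleCat.moduleOfAlgebraModule
  ModuleCat.isScalarTower_of_algebra_moduleCat

variable (ε : A →ₐ[k] k) (η : B →ₐ[k] k)

/-- The augmentation of a tensor product of augmented algebras. -/
noncomputable abbrev tensorAugmentation : A ⊗[k] B →ₐ[k] k :=
  Algebra.TensorProduct.lift ε η (fun _ _ ↦ Commute.all _ _)

/-- For `a` in the kernel of `ε`, `a ⊗ 1` is killed by the tensor augmentation and so acts as zero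
on the residue field; hence `f` kills `(a • y) ⊗ l`. -/
lemma externalTensor_map_comp_eq_zero_left {K F : ModuleCat.{u} A} (i : K ⟶ F)
    (hi : ∀ x : K, i.hom x ∈ (RingHom.ker (ε : A →+* k)) • (⊤ : Submodule A F))
    (L : ModuleCat.{u} B)
    (f : ((externalTensor k A B).obj F).obj L ⟶
      residue (tensorAugmentation ε η : A ⊗[k] B →+* k)) :
    ((externalTensor k A B).map i).app L ≫ f = 0 := by
  have key : ∀ (x : F) (l : L), x ∈ (RingHom.ker (ε : A →+* k)) • (⊤ : Submodule A F) →
      f.hom (show F ⊗[k] L from x ⊗ₜ l) = 0 := by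
    intro x l hx
    refine Submodule.smul_induction_on hx (fun a ha y _ ↦ ?_) (fun x y h h' ↦ ?_)
    · have h := f.hom.map_smul (a ⊗ₜ[k] (1 : B)) (show F ⊗[k] L from y ⊗ₜ l)
      rw [smul_residue_eq_zero] at h
      · rw [← h]
        congr 1
        exact congrArg (fun z : L ↦ (a • y) ⊗ₜ[k] z) (one_smul B l).symm
      · have : ε a = 0 := ha
        simp [RingHom.mem_ker, this]
    · have := f.hom.map_add (show F ⊗[k] L from x ⊗ₜ l) (show F ⊗[k] L from y ⊗ₜ l)
      rw [h, h', add_zero] at this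
      rw [← this]
      exact congrArg _ (TensorProduct.add_tmul x y l)
  ext x
  induction x using TensorProduct.induction_on with
  | zero => exact map_zero _
  | add x y h h' =>
    exact (map_add _ x y).trans ((congrArg₂ (· + ·) h h').trans (map_add _ x y).symm)
  | tmul m l => exact key _ l (hi m)

lemma externalTensor_map_comp_eq_zero_right {K F : ModuleCat.{u} B} (i : K ⟶ F)
    (hi : ∀ x : K, i.hom x ∈ (RingHom.ker (η : B →+* k)) • (⊤ : Submodule B F))
    (L : ModuleCat.{u} A)
    (f : ((externalTensor k A B).obj L).obj F ⟶
      residue (tensorAugmentation ε η : A ⊗[k] B →+* k)) :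
    ((externalTensor k A B).obj L).map i ≫ f = 0 := by
  have key : ∀ (x : F) (l : L), x ∈ (RingHom.ker (η : B →+* k)) • (⊤ : Submodule B F) →
      f.hom (show L ⊗[k] F from l ⊗ₜ x) = 0 := by
    intro x l hx
    refine Submodule.smul_induction_on hx (fun b hb y _ ↦ ?_) (fun x y h h' ↦ ?_)
    · have h := f.hom.map_smul ((1 : A) ⊗ₜ[k] b) (show L ⊗[k] F from l ⊗ₜ y)
      rw [smul_residue_eq_zero] at h
      · rw [← h]
        congr 1
        exact congrArg (fun z : L ↦ z ⊗ₜ[k] (b • y)) (one_smul A l).symm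
      · have : η b = 0 := hb
        simp [RingHom.mem_ker, this]
    · have := f.hom.map_add (show L ⊗[k] F from l ⊗ₜ x) (show L ⊗[k] F from l ⊗ₜ y)
      rw [h, h', add_zero] at this
      rw [← this]
      exact congrArg _ (TensorProduct.tmul_add l x y)
  ext x
  induction x using TensorProduct.induction_on with
  | zero => exact map_zero _
  | add x y h h' =>
    exact (map_add _ x y).trans ((congrArg₂ (· + ·) h h').trans (map_add _ x y).symm)
  | tmul l m => exact key _ l (hi m)

/-- The map `m ⊗ n ↦ φ m * ψ n` works; it is nonzero because `k` has no zero divisors. -/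
lemma exists_externalTensor_hom_ne_zero {M : ModuleCat.{u} A} {N : ModuleCat.{u} B}
    (φ : M →ₛₗ[(ε : A →+* k)] k) (hφ : φ ≠ 0) (ψ : N →ₛₗ[(η : B →+* k)] k) (hψ : ψ ≠ 0) :
    ∃ f : ((externalTensor k A B).obj M).obj N ⟶
      residue (tensorAugmentation ε η : A ⊗[k] B →+* k), f ≠ 0 := by
  let := Module.compHom k (tensorAugmentation ε η : A ⊗[k] B →+* k)
  have hφk (c : k) (m : M) : φ (c • m) = c * φ m := by
    rw [← algebraMap_smul A c m, map_smulₛₗ]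
    simp
  have hψk (c : k) (n : N) : ψ (c • n) = c * ψ n := by
    rw [← algebraMap_smul B c n, map_smulₛₗ]
    simp
  let φ' : M →ₗ[k] k := { toFun := φ, map_add' := map_add φ, map_smul' := hφk }
  let ψ' : N →ₗ[k] k := { toFun := ψ, map_add' := map_add ψ, map_smul' := hψk }
  let g : M ⊗[k] N →ₗ[k] k := LinearMap.mul' k k ∘ₗ TensorProduct.map φ' ψ'
  let f : M ⊗[k] N →ₗ[A ⊗[k] B] k :=
    { toFun := g
      map_add' := map_add g
      map_smul' := TensorProduct.external_map_smul g.toAddMonoidHom (fun a b m n ↦ by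
        change φ (a • m) * ψ (b • n) =
          Algebra.TensorProduct.lift ε η (fun _ _ ↦ Commute.all _ _) (a ⊗ₜ[k] b) * (φ m * ψ n)
        rw [map_smulₛₗ, map_smulₛₗ, Algebra.TensorProduct.lift_tmul]
        simp only [smul_eq_mul, RingHom.coe_coe]
        ring) }
  obtain ⟨m, hm⟩ := DFunLike.ne_iff.1 hφ
  obtain ⟨n, hn⟩ := DFunLike.ne_iff.1 hψ
  refine ⟨ModuleCat.ofHom f, fun h ↦ mul_ne_zero hm hn ?_⟩
  exact LinearMap.congr_fun (congrArg ModuleCat.Hom.hom h) (m ⊗ₜ[k] n)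

/-- Minimal syzygies of two modules give a nonzero Ext group of their external tensor product. -/
lemma HasMinimalSyzygy.nontrivial_ext_externalTensor {M : ModuleCat.{u} A} {N : ModuleCat.{u} B}
    {a b : ℕ} (hM : HasMinimalSyzygy (ε : A →+* k) a M)
    (hN : HasMinimalSyzygy (η : B →+* k) b N) :
    Nontrivial (Ext (((externalTensor k A B).obj M).obj N)
      (residue (tensorAugmentation ε η : A ⊗[k] B →+* k)) (a + b)) := by
  have hT := externalTensor_isBiexact k A B
  -- The syzygies of `M` are peeled off with `N` fixed; those of `N` follow, through the flipped
  -- bifunctor, once `M` is at stage zero.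
  induction hM with
  | zero M φ hφ =>
    rw [zero_add]
    induction hN with
    | zero N ψ hψ =>
      obtain ⟨f, hf⟩ := exists_externalTensor_hom_ne_zero ε η φ hφ ψ hψ
      exact ⟨Ext.mk₀ f, 0, fun h ↦ hf (Ext.homEquiv₀.symm.injective (by simpa using h))⟩
    | succ n S hS hP hmin _ ih =>
      have : Nontrivial (Ext (((externalTensor k A B).flip.obj S.X₁).obj M)
        (residue (tensorAugmentation ε η : A ⊗[k] B →+* k)) n) := ih
      exact hT.flip.nontrivial_ext_succ hS _
        (fun L f ↦ externalTensor_map_comp_eq_zero_right ε η S.f hmin L f) M n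
  | succ n S hS hP hmin _ ih =>
    rw [show n + 1 + b = n + b + 1 by lia]
    exact hT.nontrivial_ext_succ hS _
      (fun L f ↦ externalTensor_map_comp_eq_zero_left ε η S.f hmin L f) N (n + b)

/-- The projective dimension of an external tensor product is the sum of the projective
dimensions, provided that these are detected by minimal syzygies. -/
theorem projectiveDimension_externalTensor (M : ModuleCat.{u} A) (N : ModuleCat.{u} B)
    (hM : ∀ n, ¬ HasProjectiveDimensionLT M n → HasMinimalSyzygy (ε : A →+* k) n M)
    (hN : ∀ n, ¬ HasProjectiveDimensionLT N n → HasMinimalSyzygy (η : B →+* k) n N)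
    (hM₀ : ¬ Limits.IsZero M) (hN₀ : ¬ Limits.IsZero N) :
    projectiveDimension (((externalTensor k A B).obj M).obj N) =
      projectiveDimension M + projectiveDimension N := by
  have lower (a b : ℕ) (ha : a ≤ projectiveDimension M) (hb : b ≤ projectiveDimension N) :
      ((a + b : ℕ) : WithBot ℕ∞) ≤
        projectiveDimension (((externalTensor k A B).obj M).obj N) := by
    rw [projectiveDimension_ge_iff] at ha hb ⊢
    intro h
    have := (hM a ha).nontrivial_ext_externalTensor ε η (hN b hb)
    exact not_subsingleton (Ext _ (residue (tensorAugmentation ε η : A ⊗[k] B →+* k)) (a + b))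
      (h.subsingleton _ _ (a + b) le_rfl _)
  rw [← projectiveDimension_eq_bot_iff] at hM₀ hN₀
  have upper (a b : ℕ) (ha : projectiveDimension M ≤ a) (hb : projectiveDimension N ≤ b) :
      projectiveDimension (((externalTensor k A B).obj M).obj N) ≤ ((a + b : ℕ) : WithBot ℕ∞) := by
    rw [projectiveDimension_le_iff] at ha hb ⊢
    exact (externalTensor_isBiexact k A B).hasProjectiveDimensionLE_add M N a b
  generalize projectiveDimension M = x at *
  generalize projectiveDimension N = y at *
  generalize projectiveDimension (((externalTensor k A B).obj M).obj N) = z at *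
  -- If one factor has infinite dimension, the lower bounds force `z` to be infinite too.
  have htop (c : ℕ → ℕ) (hc : ∀ n, n ≤ c n) (h : ∀ n, ((c n : ℕ) : WithBot ℕ∞) ≤ z) : z = ⊤ := by
    induction z with
    | bot => exact absurd (h 0) (by simp)
    | coe z =>
      induction z with
      | top => rfl
      | coe z =>
        have h1 := h (z + 1)
        have h2 := hc (z + 1)
        have : c (z + 1) ≤ z := by exact_mod_cast h1
        lia
  induction x with
  | bot => exact absurd rfl hM₀
  | coe x =>
  induction y with
  | bot => exact absurd rfl hN₀
  | coe y =>
  induction x with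
  | top =>
    rw [htop (fun n ↦ n + 0) (fun n ↦ le_rfl) (fun n ↦ lower n 0 le_top (by simp))]
    rfl
  | coe x =>
  induction y with
  | top =>
    rw [htop (fun n ↦ 0 + n) (fun n ↦ by simp) (fun n ↦ lower 0 n (by simp) le_top)]
    rfl
  | coe y =>
    exact le_antisymm (by exact_mod_cast upper x y le_rfl le_rfl)
      (by exact_mod_cast lower x y le_rfl le_rfl)

end ModuleCat

/-! ### Graded free modules over polynomial rings -/

namespace MvPolynomial

variable {k : Type*} [Field k] {σ : Type*}

/-- The homomorphism `f ↦ ∑ n, fₙ tⁿ`, where `fₙ` is the homogeneous component of degree `n`. -/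
noncomputable def gradingHom : MvPolynomial σ k →ₐ[k] Polynomial (MvPolynomial σ k) :=
  aeval fun i ↦ Polynomial.X * Polynomial.C (X i)

lemma gradingHom_monomial (m : σ →₀ ℕ) (a : k) :
    gradingHom (monomial m a) = Polynomial.C (monomial m a) * Polynomial.X ^ m.degree := by
  rw [gradingHom, aeval_monomial, monomial_eq, Finsupp.degree_apply]
  simp only [mul_pow, Finsupp.prod, Finset.prod_mul_distrib, Finset.prod_pow_eq_pow_sum, map_mul,
    map_prod, map_pow]
  rw [mul_comm (Polynomial.X ^ _), ← mul_assoc]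
  rfl

lemma eval_one_gradingHom (f : MvPolynomial σ k) : (gradingHom f).eval 1 = f := by
  induction f using MvPolynomial.induction_on' with
  | monomial m a => simp [gradingHom_monomial]
  | add p q hp hq => simp [hp, hq]

lemma coeff_zero_gradingHom (f : MvPolynomial σ k) :
    (gradingHom f).coeff 0 = C (constantCoeff f) := by
  induction f using MvPolynomial.induction_on' with
  | monomial m a =>
    classical
    rw [gradingHom_monomial, Polynomial.coeff_C_mul, Polynomial.coeff_X_pow,
      constantCoeff_monomial]
    by_cases h : m = 0
    · simp [h]
    · have : ¬ 0 = m.degree := fun h' ↦ h ((Finsupp.degree_eq_zero_iff m).1 h'.symm)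
      simp [h, this]
  | add p q hp hq => simp [hp, hq]

lemma gradingHom_coeff (f : MvPolynomial σ k) (n : ℕ) :
    gradingHom ((gradingHom f).coeff n) =
      Polynomial.C ((gradingHom f).coeff n) * Polynomial.X ^ n := by
  induction f using MvPolynomial.induction_on' with
  | monomial m a =>
    rw [gradingHom_monomial, Polynomial.coeff_C_mul, Polynomial.coeff_X_pow]
    split_ifs with h
    · subst h
      simp [gradingHom_monomial]
    · simp
  | add p q hp hq => simp [hp, hq, add_mul]

section FreeModule

variable {ι : Type*}

/-- The component of degree `n` of an element of the free module on generators of degrees `e`. -/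
noncomputable def vecComponent (e : ι → ℕ) (n : ℕ) (f : ι → MvPolynomial σ k) :
    ι → MvPolynomial σ k :=
  fun i ↦ (gradingHom (f i) * Polynomial.X ^ e i).coeff n

/-- An element of the free module on generators of degrees `e` is homogeneous of degree `d`. -/
def IsHomogeneousVec (e : ι → ℕ) (d : ℕ) (g : ι → MvPolynomial σ k) : Prop :=
  ∀ i, gradingHom (g i) * Polynomial.X ^ e i = Polynomial.C (g i) * Polynomial.X ^ d

lemma isHomogeneousVec_vecComponent (e : ι → ℕ) (n : ℕ) (f : ι → MvPolynomial σ k) :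
    IsHomogeneousVec e n (vecComponent e n f) := by
  intro i
  simp only [vecComponent, Polynomial.coeff_mul_X_pow']
  split_ifs with h
  · rw [gradingHom_coeff, mul_assoc, ← pow_add, Nat.sub_add_cancel h]
  · simp

lemma sum_vecComponent [Finite ι] (e : ι → ℕ) (f : ι → MvPolynomial σ k) :
    ∃ N, f = ∑ n ∈ Finset.range N, vecComponent e n f := by
  cases nonempty_fintype ι
  -- A bound exceeding the degree of every coordinate; evaluating at `t = 1` then sums the
  -- components.
  refine ⟨(∑ i, (gradingHom (f i) * Polynomial.X ^ e i).natDegree) + 1, ?_⟩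
  ext1 i
  rw [Finset.sum_apply]
  have h := Polynomial.eval_eq_sum_range' (p := gradingHom (f i) * Polynomial.X ^ e i)
    (n := (∑ i, (gradingHom (f i) * Polynomial.X ^ e i).natDegree) + 1)
    (Nat.lt_succ_of_le (Finset.single_le_sum
      (f := fun i ↦ (gradingHom (f i) * Polynomial.X ^ e i).natDegree)
      (fun _ _ ↦ Nat.zero_le _) (Finset.mem_univ i))) 1
  simpa [eval_one_gradingHom, vecComponent] using h

/-- A submodule of a free module on generators of degrees `e` is homogeneous. -/
def IsHomogeneousSubmodule (e : ι → ℕ) (K : Submodule (MvPolynomial σ k) (ι → MvPolynomial σ k)) :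
    Prop :=
  ∀ f ∈ K, ∀ n, vecComponent e n f ∈ K

lemma IsHomogeneousSubmodule.span_eq [Finite ι] {e : ι → ℕ}
    {K : Submodule (MvPolynomial σ k) (ι → MvPolynomial σ k)} (hK : IsHomogeneousSubmodule e K) :
    Submodule.span (MvPolynomial σ k) {g | g ∈ K ∧ ∃ d, IsHomogeneousVec e d g} = K := by
  refine le_antisymm (Submodule.span_le.2 fun g hg ↦ hg.1) fun f hf ↦ ?_
  obtain ⟨N, hN⟩ := sum_vecComponent e f
  rw [hN]
  exact Submodule.sum_mem _ fun n _ ↦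
    Submodule.subset_span ⟨hK f hf n, n, isHomogeneousVec_vecComponent e n f⟩

/-- Homogeneous generators make `c ↦ ∑ j, c j • g j` degree-preserving, which is why its kernel is
homogeneous. -/
lemma vecComponent_sum_smul {κ : Type*} [Fintype κ] (e : ι → ℕ) (d : κ → ℕ)
    (g : κ → ι → MvPolynomial σ k) (hg : ∀ j, IsHomogeneousVec e (d j) (g j)) (n : ℕ)
    (c : κ → MvPolynomial σ k) :
    vecComponent e n (∑ j, c j • g j) = ∑ j, vecComponent d n c j • g j := by
  ext1 i
  simp only [vecComponent, Finset.sum_apply, Pi.smul_apply, smul_eq_mul, map_sum, map_mul,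
    Finset.sum_mul, Polynomial.finsetSum_coeff]
  refine Finset.sum_congr rfl fun j _ ↦ ?_
  rw [mul_assoc, hg j i, mul_left_comm, Polynomial.coeff_C_mul, mul_comm]

/-- A homogeneous submodule of a free module of finite rank has a minimal homogeneous
presentation. -/
lemma IsHomogeneousSubmodule.exists_minimal_presentation {k : Type u} [Field k] {σ : Type v}
    [Finite σ] {ι : Type (max u v)} [Finite ι] {e : ι → ℕ}
    {K : Submodule (MvPolynomial σ k) (ι → MvPolynomial σ k)} (hK : IsHomogeneousSubmodule e K) :
    ∃ (κ : Type (max u v)) (_ : Finite κ) (d : κ → ℕ)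
      (p : (κ → MvPolynomial σ k) →ₗ[MvPolynomial σ k] K), Function.Surjective p ∧
      IsHomogeneousSubmodule d (LinearMap.ker p) ∧
      ∀ c ∈ LinearMap.ker p, ∀ j, constantCoeff (c j) = 0 := by
  classical
  let R := MvPolynomial σ k
  let H : Set (ι → R) := {g | g ∈ K ∧ ∃ d, IsHomogeneousVec e d g}
  have hfin : ∃ t : Finset (ι → R), ↑t ⊆ H ∧ Submodule.span R (t : Set (ι → R)) = K := by
    have hfg : (Submodule.span R H).FG := IsNoetherian.noetherian _
    obtain ⟨t, ht, hspan⟩ := (Submodule.fg_span_iff_fg_span_finset_subset H).1 hfg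
    exact ⟨t, ht, by rw [← hspan, hK.span_eq]⟩
  obtain ⟨t, ⟨htH, htK⟩, hmin⟩ := exists_minimal_of_wellFoundedLT
    (fun t : Finset (ι → R) ↦ ↑t ⊆ H ∧ Submodule.span R (t : Set (ι → R)) = K) hfin
  choose d hd using fun g : t ↦ (htH g.2).2
  let q : (t → R) →ₗ[R] (ι → R) := Fintype.linearCombination R (fun g : t ↦ (g : ι → R))
  have hq : LinearMap.range q = K := by
    rw [Fintype.range_linearCombination, Subtype.range_coe_subtype]
    exact htK
  let p : (t → R) →ₗ[R] K := q.codRestrict K fun c ↦ hq ▸ LinearMap.mem_range_self q c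
  have hker (c : t → R) : c ∈ LinearMap.ker p ↔ ∑ g : t, c g • (g : ι → R) = 0 := by
    rw [LinearMap.ker_codRestrict, LinearMap.mem_ker, Fintype.linearCombination_apply]
  have hhom : IsHomogeneousSubmodule d (LinearMap.ker p) := by
    intro c hc n
    rw [hker] at hc ⊢
    rw [← vecComponent_sum_smul e d _ hd, hc]
    ext1 i
    simp [vecComponent]
  refine ⟨t, inferInstance, d, p, ?_, hhom, fun c hc g ↦ ?_⟩
  · rintro ⟨x, hx⟩
    obtain ⟨c, hc⟩ := hq.symm ▸ hx
    exact ⟨c, Subtype.ext hc⟩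
  -- The component of the relation `c` in degree `d g` is again a relation, and its coefficient at
  -- `g` is the nonzero scalar `constantCoeff (c g)`. So `g` lies in the span of the other
  -- generators, against the minimality of `t`.
  by_contra hne
  have h := (hker _).1 (hhom c hc (d g))
  have hg : vecComponent d (d g) c g = C (constantCoeff (c g)) := by
    simp [vecComponent, Polynomial.coeff_mul_X_pow', coeff_zero_gradingHom]
  rw [← Finset.add_sum_erase _ _ (Finset.mem_univ g), hg] at h
  have hmem : (g : ι → R) ∈ Submodule.span R ((t.erase g : Finset (ι → R)) : Set (ι → R)) := by
    have h' : -(C (constantCoeff (c g))⁻¹ : R) •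
        ∑ j ∈ Finset.univ.erase g, vecComponent d (d g) c j • (j : ι → R) = g := by
      rw [← eq_neg_iff_add_eq_zero] at h
      rw [neg_smul, ← smul_neg, ← h, smul_smul, ← C_mul, inv_mul_cancel₀ hne, C_1, one_smul]
    suffices hsum : ∑ j ∈ Finset.univ.erase g, vecComponent d (d g) c j • (j : ι → R) ∈
        Submodule.span R ((t.erase g : Finset (ι → R)) : Set (ι → R)) by
      have := Submodule.smul_mem _ (-(C (constantCoeff (c g))⁻¹ : R)) hsum
      rwa [h'] at this
    refine Submodule.sum_mem _ fun j hj ↦ Submodule.smul_mem _ _ (Submodule.subset_span ?_)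
    simp only [Finset.coe_erase, Set.mem_sdiff, Finset.mem_coe, Set.mem_singleton_iff]
    exact ⟨j.2, fun hjg ↦ (Finset.mem_erase.1 hj).1 (Subtype.ext hjg)⟩
  have herase : t ⊆ t.erase g := hmin ⟨fun x hx ↦ htH (Finset.erase_subset _ _ hx), by
    rw [← htK]
    refine le_antisymm (Submodule.span_mono (Finset.erase_subset _ _)) (Submodule.span_le.2 ?_)
    intro x hx
    by_cases hxg : x = g
    · exact hxg ▸ hmem
    · exact Submodule.subset_span (Finset.mem_erase.2 ⟨hxg, hx⟩)⟩ (Finset.erase_subset _ _)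
  exact Finset.notMem_erase _ _ (herase g.2)

end FreeModule

end MvPolynomial

/-! ### Minimal syzygies from homogeneous presentations -/

namespace ModuleCat

open CategoryTheory MvPolynomial

/-- For a module with a minimal homogeneous presentation over a polynomial ring, lower bounds of
the projective dimension are witnessed by minimal syzygies. -/
lemma hasMinimalSyzygy_of_presentation {k : Type u} [Field k] {σ : Type} [Finite σ]
    (n : ℕ) (M : ModuleCat.{u} (MvPolynomial σ k)) {ι : Type u} [Finite ι] (e : ι → ℕ)
    (p : (ι → MvPolynomial σ k) →ₗ[MvPolynomial σ k] M) (hp : Function.Surjective p)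
    (hhom : IsHomogeneousSubmodule e (LinearMap.ker p))
    (hmin : ∀ c ∈ LinearMap.ker p, ∀ j, constantCoeff (c j) = 0)
    (hn : ¬ HasProjectiveDimensionLT M n) :
    HasMinimalSyzygy (constantCoeff : MvPolynomial σ k →+* k) n M := by
  induction n generalizing M ι with
  | zero =>
    rw [hasProjectiveDimensionLT_zero_iff_isZero, ModuleCat.isZero_iff_subsingleton,
      not_subsingleton_iff_nontrivial] at hn
    obtain ⟨i⟩ : Nonempty ι := by
      by_contra h
      rw [not_nonempty_iff] at h
      exact not_subsingleton M hp.subsingleton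
    -- Relations have no constant terms, so the constant term of a coordinate depends only on the
    -- image under `p`; an arbitrary section thus yields a semilinear functional.
    have key (c c' : ι → MvPolynomial σ k) (h : p c = p c') :
        constantCoeff (c i) = constantCoeff (c' i) := by
      have := hmin (c - c') (by rw [LinearMap.mem_ker, map_sub, h, sub_self]) i
      rwa [Pi.sub_apply, map_sub, sub_eq_zero] at this
    let s := Function.surjInv hp
    have hs (m : M) : p (s m) = m := Function.surjInv_eq hp m
    refine .zero M { toFun := fun m ↦ constantCoeff (s m i), map_add' := fun m m' ↦ ?_,
                     map_smul' := fun a m ↦ ?_ } fun h ↦ ?_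
    · rw [← map_add, ← Pi.add_apply]
      exact key _ _ (by rw [map_add, hs, hs, hs])
    · rw [smul_eq_mul, ← map_mul, ← smul_eq_mul a, ← Pi.smul_apply]
      exact key _ _ (by rw [map_smul, hs, hs])
    · have := DFunLike.congr_fun h (p fun _ ↦ 1)
      change constantCoeff (s (p fun _ ↦ 1) i) = 0 at this
      rw [key _ (fun _ ↦ 1) (hs _), map_one] at this
      exact one_ne_zero this
  | succ n ih =>
    classical
    cases nonempty_fintype ι
    obtain ⟨κ, _, d, q, hq, hqhom, hqmin⟩ := hhom.exists_minimal_presentation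
    let S : ShortComplex (ModuleCat.{u} (MvPolynomial σ k)) :=
      ShortComplex.mk (ModuleCat.ofHom (LinearMap.ker p).subtype) (ModuleCat.ofHom p)
        (by ext x; exact x.2)
    have hS : S.ShortExact := ModuleCat.shortComplex_shortExact _
      (LinearMap.exact_subtype_ker_map p) (Submodule.subtype_injective _) hp
    have hP : Projective S.X₂ := (IsProjective.iff_projective _).1
      (inferInstanceAs (Module.Projective (MvPolynomial σ k) (ι → MvPolynomial σ k)))
    refine .succ n S hS hP (fun x ↦ ?_) (ih (ModuleCat.of _ (LinearMap.ker p)) d q hq hqhom hqmin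
      fun h ↦ hn ?_)
    · have hx := hmin x.1 x.2
      change x.1 ∈ _ • (⊤ : Submodule (MvPolynomial σ k) (ι → MvPolynomial σ k))
      rw [pi_eq_sum_univ x.1]
      exact Submodule.sum_mem _ fun i _ ↦ Submodule.smul_mem_smul (hx i) trivial
    · exact hS.hasProjectiveDimensionLT_X₃ n h inferInstance

end ModuleCat

/-! ### Cyclic modules: change of rings and tensor products -/

namespace ModuleCat

open CategoryTheory

attribute [local instance] RingHomInvPair.of_ringEquiv in
/-- The projective dimension of a cyclic module is invariant under ring isomorphisms. -/
lemma projectiveDimension_quotient_eq_of_ringEquiv {R : Type u} {R' : Type v} [CommRing R]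
    [CommRing R'] (e : R ≃+* R') (I : Ideal R) (J : Ideal R') (h : J = I.map (e : R →+* R')) :
    projectiveDimension (ModuleCat.of R (R ⧸ I)) =
      projectiveDimension (ModuleCat.of R' (R' ⧸ J)) := by
  let q := Ideal.quotientEquiv I J e h
  let e' : (R ⧸ I) ≃ₛₗ[RingHomClass.toRingHom e] (R' ⧸ J) :=
    { q with
      map_smul' := fun a x ↦ by
        obtain ⟨x, rfl⟩ := Ideal.Quotient.mk_surjective x
        change q (Ideal.Quotient.mk I a * Ideal.Quotient.mk I x) =
          Ideal.Quotient.mk J (e a) * q (Ideal.Quotient.mk I x)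
        rw [map_mul]
        rfl }
  exact projectiveDimension_eq_of_semiLinearEquiv.{u, v} (M := ModuleCat.of R (R ⧸ I))
    (N := ModuleCat.of R' (R' ⧸ J)) e e'

attribute [local instance] TensorProduct.externalModule ModuleCat.moduleOfAlgebraModule
  ModuleCat.isScalarTower_of_algebra_moduleCat in
/-- The external tensor product of two cyclic modules is cyclic. -/
lemma projectiveDimension_externalTensor_of_surjective (k : Type u) {A B : Type u} [Field k]
    [CommRing A] [CommRing B] [Algebra k A] [Algebra k B]
    {M : ModuleCat.{u} A} {N : ModuleCat.{u} B} (f : A →ₗ[A] M) (hf : Function.Surjective f)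
    (g : B →ₗ[B] N) (hg : Function.Surjective g) :
    projectiveDimension (((externalTensor k A B).obj M).obj N) =
    projectiveDimension (ModuleCat.of (A ⊗[k] B) ((A ⊗[k] B) ⧸
      (Ideal.map (Algebra.TensorProduct.includeLeft : A →ₐ[k] A ⊗[k] B) (LinearMap.ker f) ⊔
        Ideal.map (Algebra.TensorProduct.includeRight : B →ₐ[k] A ⊗[k] B)
          (LinearMap.ker g)))) := by
  let p : A ⊗[k] B →ₗ[A ⊗[k] B] M ⊗[k] N := LinearMap.toSpanSingleton _ _ (f 1 ⊗ₜ[k] g 1)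
  have hp (x : A ⊗[k] B) :
      p x = TensorProduct.map (f.restrictScalars k) (g.restrictScalars k) x := by
    induction x with
    | zero => simp
    | add x y h h' => rw [map_add, h, h', map_add]
    | tmul a b =>
      change (a • f 1) ⊗ₜ[k] (b • g 1) = f a ⊗ₜ[k] g b
      rw [← map_smul, ← map_smul, smul_eq_mul, smul_eq_mul, mul_one, mul_one]
  have hsurj : Function.Surjective p := fun y ↦ by
    obtain ⟨x, hx⟩ := TensorProduct.map_surjective (R := k) (g := f.restrictScalars k) hf
      (g' := g.restrictScalars k) hg y
    exact ⟨x, (hp x).trans hx⟩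
  have hexact_left : Function.Exact (((LinearMap.ker f).restrictScalars k).subtype)
      (f.restrictScalars k) := LinearMap.exact_subtype_ker_map f
  have hexact_right : Function.Exact (((LinearMap.ker g).restrictScalars k).subtype)
      (g.restrictScalars k) := LinearMap.exact_subtype_ker_map g
  have hker : LinearMap.ker p =
      Ideal.map (Algebra.TensorProduct.includeLeft : A →ₐ[k] A ⊗[k] B) (LinearMap.ker f) ⊔
        Ideal.map (Algebra.TensorProduct.includeRight : B →ₐ[k] A ⊗[k] B) (LinearMap.ker g) := by
    apply Submodule.restrictScalars_injective k
    -- By right exactness, the kernel of `f ⊗ g` is the sum of the images of `ker f ⊗ B` and `A ⊗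
    -- ker g`.
    rw [Submodule.restrictScalars_sup, Ideal.map_includeLeft_eq, Ideal.map_includeRight_eq,
      sup_comm, ← TensorProduct.map_ker hexact_left hf hexact_right hg]
    ext x
    rw [Submodule.restrictScalars_mem, LinearMap.mem_ker, LinearMap.mem_ker, hp]
  rw [← hker]
  exact projectiveDimension_eq_of_iso
    (LinearEquiv.toModuleIso (p.quotKerEquivOfSurjective hsurj)).symm

end ModuleCat

/-! ### Graph ideals and disjoint unions -/

namespace SimpleGraph

open MvPolynomial CategoryTheory

section

variable {k : Type u} [Field k] {V : Type v}

lemma graphIdeal_le_ker_constantCoeff (G : SimpleGraph V) :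
    G.graphIdeal k ≤ RingHom.ker (constantCoeff : MvPolynomial V k →+* k) := by
  rw [graphIdeal, Ideal.span_le]
  rintro _ ⟨a, b, _, rfl⟩
  simp [RingHom.mem_ker]

lemma nontrivial_quotient_graphIdeal (G : SimpleGraph V) :
    Nontrivial (MvPolynomial V k ⧸ G.graphIdeal k) := by
  refine Ideal.Quotient.nontrivial_iff.2 fun h ↦ ?_
  have : (1 : MvPolynomial V k) ∈ G.graphIdeal k := h ▸ trivial
  simpa [RingHom.mem_ker] using G.graphIdeal_le_ker_constantCoeff this

/-- The ideal is homogeneous because its generators are monomials. -/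
lemma coeff_gradingHom_mem_graphIdeal (G : SimpleGraph V) (f : MvPolynomial V k)
    (hf : f ∈ G.graphIdeal k) (n : ℕ) : (gradingHom f).coeff n ∈ G.graphIdeal k := by
  induction hf using Submodule.span_induction generalizing n with
  | mem x hx =>
    obtain ⟨a, b, hab, rfl⟩ := id hx
    have hmon : (X a * X b : MvPolynomial V k) =
        monomial (Finsupp.single a 1 + Finsupp.single b 1) 1 := by
      simp [X, monomial_mul]
    rw [hmon, gradingHom_monomial, ← hmon, Polynomial.coeff_C_mul]
    exact Ideal.mul_mem_right _ _ (Ideal.subset_span hx)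
  | zero => simp
  | add x y _ _ hx hy => simpa using add_mem (hx n) (hy n)
  | smul r x _ hx =>
    rw [smul_eq_mul, map_mul, Polynomial.coeff_mul]
    exact Ideal.sum_mem _ fun c _ ↦ Ideal.mul_mem_left _ _ (hx c.2)

/-- The projective dimension of a graph is invariant under isomorphisms. -/
lemma pd_eq_of_iso {V' : Type*} {G : SimpleGraph V} {G' : SimpleGraph V'} (φ : G ≃g G') :
    G.pd k = G'.pd k := by
  refine ModuleCat.projectiveDimension_quotient_eq_of_ringEquiv
    (renameEquiv k φ.toEquiv).toRingEquiv _ _ ?_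
  rw [graphIdeal, graphIdeal, Ideal.map_span]
  congr 1
  ext p
  constructor
  · rintro ⟨a, b, hab, rfl⟩
    exact ⟨_, ⟨φ.symm a, φ.symm b, φ.symm.map_adj_iff.2 hab, rfl⟩, by
      simp [renameEquiv_apply, rename_X]⟩
  · rintro ⟨_, ⟨a, b, hab, rfl⟩, rfl⟩
    exact ⟨φ a, φ b, φ.map_adj_iff.2 hab, by simp [renameEquiv_apply, rename_X]⟩

lemma pd_eq_zero_of_isEmpty [IsEmpty V] (G : SimpleGraph V) : G.pd k = 0 := by
  have h : G.graphIdeal k = ⊥ := by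
    rw [graphIdeal, Ideal.span_eq_bot]
    rintro _ ⟨a, _⟩
    exact isEmptyElim a
  have := G.nontrivial_quotient_graphIdeal (k := k)
  have : Module.Projective (MvPolynomial V k) (MvPolynomial V k ⧸ G.graphIdeal k) :=
    Module.Projective.of_equiv (Submodule.quotEquivOfEqBot _ h).symm
  have : Projective (ModuleCat.of (MvPolynomial V k) (MvPolynomial V k ⧸ G.graphIdeal k)) :=
    (IsProjective.iff_projective _).1 this
  exact ModuleCat.projectiveDimension_eq_zero_of_projective _

end

/-- The quotient map is a presentation on one generator of degree `0`, minimal since elements of the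
graph ideal have no constant term. -/
lemma hasMinimalSyzygy_quotient_graphIdeal {k : Type u} [Field k] {V : Type} [Finite V]
    (G : SimpleGraph V) (n : ℕ)
    (hn : ¬ HasProjectiveDimensionLT
      (ModuleCat.of (MvPolynomial V k) (MvPolynomial V k ⧸ G.graphIdeal k)) n) :
    ModuleCat.HasMinimalSyzygy (constantCoeff : MvPolynomial V k →+* k) n
      (ModuleCat.of (MvPolynomial V k) (MvPolynomial V k ⧸ G.graphIdeal k)) := by
  let p : (PUnit.{u + 1} → MvPolynomial V k) →ₗ[MvPolynomial V k]
      MvPolynomial V k ⧸ G.graphIdeal k := (G.graphIdeal k).mkQ ∘ₗ LinearMap.proj PUnit.unit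
  have hker (f : PUnit.{u + 1} → MvPolynomial V k) :
      f ∈ LinearMap.ker p ↔ f PUnit.unit ∈ G.graphIdeal k := by
    rw [LinearMap.mem_ker]
    exact Ideal.Quotient.eq_zero_iff_mem
  refine ModuleCat.hasMinimalSyzygy_of_presentation n _ (fun _ ↦ 0) p
    ((G.graphIdeal k).mkQ_surjective.comp fun x ↦ ⟨fun _ ↦ x, rfl⟩) (fun f hf m ↦ ?_)
    (fun f hf _ ↦ G.graphIdeal_le_ker_constantCoeff ((hker f).1 hf)) hn
  rw [hker] at hf ⊢
  simpa [vecComponent] using G.coeff_gradingHom_mem_graphIdeal _ hf m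

lemma graphIdeal_sum {k : Type u} [Field k] {V₁ V₂ : Type} (G₁ : SimpleGraph V₁)
    (G₂ : SimpleGraph V₂) :
    (G₁ ⊕g G₂).graphIdeal k =
      ((G₁.graphIdeal k).map (Algebra.TensorProduct.includeLeft :
          MvPolynomial V₁ k →ₐ[k] MvPolynomial V₁ k ⊗[k] MvPolynomial V₂ k) ⊔
        (G₂.graphIdeal k).map (Algebra.TensorProduct.includeRight :
          MvPolynomial V₂ k →ₐ[k] MvPolynomial V₁ k ⊗[k] MvPolynomial V₂ k)).map
        ((tensorEquivSum k V₁ V₂ k).toRingEquiv :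
          MvPolynomial V₁ k ⊗[k] MvPolynomial V₂ k →+* MvPolynomial (V₁ ⊕ V₂) k) := by
  have h₁ (a b : V₁) : tensorEquivSum k V₁ V₂ k ((X a * X b) ⊗ₜ 1) =
      X (Sum.inl a) * X (Sum.inl b) := by
    rw [← tensorEquivSum_X_tmul_one (R := k) (ι := V₂),
      ← tensorEquivSum_X_tmul_one (R := k) (ι := V₂),
      ← map_mul, Algebra.TensorProduct.tmul_mul_tmul, one_mul]
  have h₂ (a b : V₂) : tensorEquivSum k V₁ V₂ k (1 ⊗ₜ (X a * X b)) =
      X (Sum.inr a) * X (Sum.inr b) := by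
    rw [← tensorEquivSum_one_tmul_X (R := k) (σ := V₁),
      ← tensorEquivSum_one_tmul_X (R := k) (σ := V₁),
      ← map_mul, Algebra.TensorProduct.tmul_mul_tmul, one_mul]
  simp only [graphIdeal, Ideal.map_span, ← Ideal.span_union]
  congr 1
  ext p
  constructor
  · rintro ⟨a | a, b | b, hab, rfl⟩
    · exact ⟨_, Or.inl ⟨_, ⟨a, b, hab, rfl⟩, rfl⟩, h₁ a b⟩
    · exact absurd hab (by simp)
    · exact absurd hab (by simp)
    · exact ⟨_, Or.inr ⟨_, ⟨a, b, hab, rfl⟩, rfl⟩, h₂ a b⟩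
  · rintro ⟨_, ⟨_, ⟨a, b, hab, rfl⟩, rfl⟩ | ⟨_, ⟨a, b, hab, rfl⟩, rfl⟩, rfl⟩
    · exact ⟨Sum.inl a, Sum.inl b, hab, h₁ a b⟩
    · exact ⟨Sum.inr a, Sum.inr b, hab, h₂ a b⟩

/-- Vertices in `Type` keep both polynomial rings in the universe of `k`, as `externalTensor`
requires. -/
lemma pd_sum_of_small {k : Type u} [Field k] {V₁ V₂ : Type} [Finite V₁] [Finite V₂]
    (G₁ : SimpleGraph V₁) (G₂ : SimpleGraph V₂) : (G₁ ⊕g G₂).pd k = G₁.pd k + G₂.pd k := by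
  let ε (V : Type) : MvPolynomial V k →ₐ[k] k :=
    { (constantCoeff : MvPolynomial V k →+* k) with commutes' := fun a ↦ constantCoeff_C V a }
  have h₀ {V : Type} (G : SimpleGraph V) : ¬ Limits.IsZero
      (ModuleCat.of (MvPolynomial V k) (MvPolynomial V k ⧸ G.graphIdeal k)) := by
    rw [ModuleCat.isZero_iff_subsingleton, not_subsingleton_iff_nontrivial]
    exact G.nontrivial_quotient_graphIdeal
  have h := ModuleCat.projectiveDimension_externalTensor (ε V₁) (ε V₂) _ _
    G₁.hasMinimalSyzygy_quotient_graphIdeal G₂.hasMinimalSyzygy_quotient_graphIdeal (h₀ G₁) (h₀ G₂)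
  rw [ModuleCat.projectiveDimension_externalTensor_of_surjective k
    (G₁.graphIdeal k).mkQ (Submodule.mkQ_surjective _)
    (G₂.graphIdeal k).mkQ (Submodule.mkQ_surjective _), Submodule.ker_mkQ, Submodule.ker_mkQ] at h
  rw [pd, pd, pd, ← h]
  exact (ModuleCat.projectiveDimension_quotient_eq_of_ringEquiv _ _ _
    (graphIdeal_sum G₁ G₂)).symm

/-- The projective dimension is additive on disjoint unions of graphs. -/
lemma pd_sum {k : Type u} [Field k] {V₁ V₂ : Type*} [Finite V₁] [Finite V₂]
    (G₁ : SimpleGraph V₁) (G₂ : SimpleGraph V₂) : (G₁ ⊕g G₂).pd k = G₁.pd k + G₂.pd k := by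
  let φ₁ := Iso.map (Finite.equivFin V₁) G₁
  let φ₂ := Iso.map (Finite.equivFin V₂) G₂
  rw [pd_eq_of_iso φ₁, pd_eq_of_iso φ₂, ← pd_sum_of_small, pd_eq_of_iso (Iso.sumCongr φ₁ φ₂)]

/-! ### Connected components -/

/-- The graph induced on a union of connected components is the disjoint union of any one of
them and the graph induced on the others. -/
lemma nonempty_iso_induce_insert {V : Type*} (G : SimpleGraph V)
    [DecidableEq G.ConnectedComponent] (C : G.ConnectedComponent)
    (s : Finset G.ConnectedComponent) (hC : C ∉ s) :
    Nonempty (C.toSimpleGraph ⊕g G.induce {v | G.connectedComponentMk v ∈ s} ≃g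
      G.induce {v | G.connectedComponentMk v ∈ insert C s}) := by
  have hne {v : V} (hv : v ∈ C) : G.connectedComponentMk v ∉ s := by
    have : G.connectedComponentMk v = C := hv
    rwa [this]
  have hadj {v w : V} (h : G.Adj v w) : G.connectedComponentMk v = G.connectedComponentMk w :=
    ConnectedComponent.sound h.reachable
  let f : C ⊕ {v | G.connectedComponentMk v ∈ s} → {v | G.connectedComponentMk v ∈ insert C s} :=
    Sum.elim (fun v ↦ ⟨v.1, Finset.mem_insert.2 (Or.inl v.2)⟩)
      (fun v ↦ ⟨v.1, Finset.mem_insert_of_mem v.2⟩)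
  have hf : Function.Bijective f := by
    constructor
    · rintro (⟨v, hv⟩ | ⟨v, hv⟩) (⟨w, hw⟩ | ⟨w, hw⟩) h
      all_goals obtain rfl : v = w := congrArg Subtype.val h
      · rfl
      · exact absurd hw (hne hv)
      · exact absurd hv (hne hw)
      · rfl
    · rintro ⟨v, hv⟩
      rcases Finset.mem_insert.1 hv with hv | hv
      · exact ⟨Sum.inl ⟨v, hv⟩, rfl⟩
      · exact ⟨Sum.inr ⟨v, hv⟩, rfl⟩
  refine ⟨⟨Equiv.ofBijective f hf, ?_⟩⟩
  -- Mixed pairs are adjacent on neither side: an edge of `G` keeps both ends in one component, and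
  -- `C ∉ s`.
  rintro (⟨v, hv⟩ | ⟨v, hv⟩) (⟨w, hw⟩ | ⟨w, hw⟩)
  · exact Iff.rfl
  · exact ⟨fun h ↦ absurd (show G.connectedComponentMk v ∈ s from hadj h ▸ hw) (hne hv),
      fun h ↦ absurd h (by simp)⟩
  · exact ⟨fun h ↦ absurd (show G.connectedComponentMk w ∈ s from hadj h ▸ hv) (hne hw),
      fun h ↦ absurd h (by simp)⟩
  · exact Iff.rfl

lemma pd_induce_components {k : Type u} [Field k] {V : Type*} [Finite V] (G : SimpleGraph V)
    (s : Finset G.ConnectedComponent) :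
    (G.induce {v | G.connectedComponentMk v ∈ s}).pd k = ∑ C ∈ s, C.toSimpleGraph.pd k := by
  classical
  induction s using Finset.induction_on with
  | empty =>
    have : IsEmpty {v | G.connectedComponentMk v ∈ (∅ : Finset G.ConnectedComponent)} := by
      simp [Set.isEmpty_coe_sort]
    rw [pd_eq_zero_of_isEmpty, Finset.sum_empty]
  | insert C s hC ih =>
    have : Finite C := Subtype.finite
    obtain ⟨φ⟩ := G.nonempty_iso_induce_insert C s hC
    rw [Finset.sum_insert hC, ← ih, ← pd_sum, pd_eq_of_iso φ]

end SimpleGraph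

theorem mainTheorem8 {k : Type*} [Field k] :
    (∀ {V₁ : Type*} {V₂ : Type*} {V : Type*} [Finite V₁] [Finite V₂] [Finite V]
      (G₁ : SimpleGraph V₁) (G₂ : SimpleGraph V₂) (G : SimpleGraph V),
      Nonempty (G ≃g G₁ ⊕g G₂) → G.pd k = G₁.pd k + G₂.pd k) ∧
    (∀ {V : Type*} [Finite V] (G : SimpleGraph V) [Fintype G.ConnectedComponent],
      G.pd k = ∑ C : G.ConnectedComponent, C.toSimpleGraph.pd k) := by
  refine ⟨fun G₁ G₂ G ⟨φ⟩ ↦ ?_, fun {V} _ G _ ↦ ?_⟩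
  · rw [SimpleGraph.pd_eq_of_iso φ, SimpleGraph.pd_sum]
  · rw [← G.pd_induce_components]
    -- With `s` the set of all components, the induced graph is `G` itself.
    exact SimpleGraph.pd_eq_of_iso (RelIso.mk (Equiv.subtypeUnivEquiv (by simp)).symm Iff.rfl)
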